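/- Let $K$ be an algebraically closed field of arbitrary characteristic, let $n\ge 2$, and identify $\mathbb G_m^n$ with the group $(K\setminus\{0\})^n$ with its Zariski topology, whose closed sets are the zero sets of Laurent polynomials in $K[X_1^{\pm1},\dots,X_n^{\pm1}]$. A *hypersurface* is the zero set in $\mathbb G_m^n$ of a Laurent polynomial that is neither zero nor a unit. A *linear torus* is an irreducible algebraic subgroup $G$ of $\mathbb G_m^n$, and a *torsion coset* is a set $\boldsymbol\zeta G$ with $\boldsymbol\zeta\in\mathbb G_m^n$ of finite order and $G$ a linear torus. An algebraic subset $X\subset\mathbb G_m^n$ of dimension $d$ is *admissible* if it is finite, or if $d\ge 1$ and $X$ contains no torsion coset of dimension $d$. For real $T\ge1$ let $X_T$ be the set of points of $X$ that have finite order at most $T$ in the group $\mathbb G_m^n$. If $X\subset\mathbb G_m^n$ is an admissible hypersurface, then there is a constant $c>0$, depending only on $X$, such that for all real $T\ge 1$ the set $X_T$ is finite and $$\#X_T\le c\,T^{\,n-1/n}.$$ -/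

import Mathlib

/-- The group `𝔾_m^n(K) = (K \ {0})^n` of `K`-points of the algebraic torus. -/
abbrev Torus (K : Type*) [Field K] (n : ℕ) : Type _ := Fin n → Kˣ

/-- The ring `K[X₁^{±1}, …, X_n^{±1}]` of Laurent polynomials in `n` variables, that is the
group algebra of `ℤ^n`. -/
abbrev LaurentRing (K : Type*) [Field K] (n : ℕ) : Type _ := AddMonoidAlgebra K (Fin n → ℤ)

namespace Torus

variable {K : Type*} [Field K] {n : ℕ}

/-- The monomial `x^a = x₁^{a₁} ⋯ x_n^{a_n}`, as a homomorphism in the exponent `a ∈ ℤ^n`. -/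
def monomialHom (x : Torus K n) : Multiplicative (Fin n → ℤ) →* K where
  toFun a := ((∏ i, x i ^ (Multiplicative.toAdd a i) : Kˣ) : K)
  map_one' := by simp
  map_mul' a b := by simp [zpow_add, Finset.prod_mul_distrib]

/-- The value `P(x) = ∑ p_a x^a` of a Laurent polynomial `P = ∑ p_a X^a` at the point `x`. -/
noncomputable def eval (x : Torus K n) : LaurentRing K n →ₐ[K] K :=
  AddMonoidAlgebra.lift K K (Fin n → ℤ) (monomialHom x)

/-- The zero locus `Z(P)` of a Laurent polynomial. -/
def zeroLocus (P : LaurentRing K n) : Set (Torus K n) := {x | eval x P = 0}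

/-- The common zero locus of a set of Laurent polynomials. -/
def commonZeros (S : Set (LaurentRing K n)) : Set (Torus K n) := {x | ∀ P ∈ S, eval x P = 0}

variable (K n) in
/-- The Zariski topology on `𝔾_m^n(K)`: the closed sets are the common zero loci of sets of
Laurent polynomials. -/
@[reducible] def zariski : TopologicalSpace (Torus K n) :=
  TopologicalSpace.ofClosed {X | ∃ S : Set (LaurentRing K n), X = commonZeros S}
    ⟨{1}, by ext x; simp [commonZeros]⟩
    (by
      intro A hA
      refine ⟨{P | ∃ X ∈ A, ∀ x ∈ X, eval x P = 0}, ?_⟩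
      ext x
      simp only [Set.mem_sInter, commonZeros, Set.mem_ofPred_eq]
      constructor
      · rintro h P ⟨X, hX, hP⟩
        exact hP x (h X hX)
      · intro h X hX
        obtain ⟨S, rfl⟩ := hA hX
        exact fun P hP => h P ⟨_, hX, fun y hy => hy P hP⟩)
    (by
      rintro _ ⟨S, rfl⟩ _ ⟨S', rfl⟩
      refine ⟨{R | ∃ P ∈ S, ∃ Q ∈ S', R = P * Q}, ?_⟩
      ext x
      simp only [Set.mem_union, commonZeros, Set.mem_ofPred_eq]
      constructor
      · rintro (h | h) _ ⟨P, hP, Q, hQ, rfl⟩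
        · rw [map_mul, h P hP, zero_mul]
        · rw [map_mul, h Q hQ, mul_zero]
      · intro h
        by_contra! hc
        obtain ⟨⟨P, hP, hPx⟩, Q, hQ, hQx⟩ := hc
        have := h _ ⟨P, hP, Q, hQ, rfl⟩
        rw [map_mul] at this
        exact (mul_ne_zero hPx hQx) this)

/-- An algebraic subset of the torus: the zero set of finitely many Laurent polynomials. -/
def IsAlgebraicSet (X : Set (Torus K n)) : Prop :=
  ∃ S : Finset (LaurentRing K n), X = commonZeros (S : Set (LaurentRing K n))

/-- The dimension of a subset of the torus: its Krull dimension in the Zariski topology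
(`⊥` for the empty set). -/
noncomputable def dim (X : Set (Torus K n)) : WithBot ℕ∞ :=
  @topologicalKrullDim X (@instTopologicalSpaceSubtype _ (· ∈ X) (zariski K n))

/-- A linear torus: an irreducible algebraic subgroup of `𝔾_m^n`. -/
def IsLinearTorus (G : Subgroup (Torus K n)) : Prop :=
  IsAlgebraicSet (G : Set (Torus K n)) ∧ @IsIrreducible _ (zariski K n) (G : Set (Torus K n))

/-- A torsion coset `ζG`, where `ζ` is a point of finite order and `G` is a linear torus. -/
def IsTorsionCoset (C : Set (Torus K n)) : Prop :=
  ∃ (ζ : Torus K n) (G : Subgroup (Torus K n)), IsOfFinOrder ζ ∧ IsLinearTorus G ∧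
    C = (fun g => ζ * g) '' (G : Set (Torus K n))

/-- An algebraic set `X` is admissible if it is finite, or if its dimension `d` is at least `1`
and it contains no torsion coset of dimension `d`. -/
def IsAdmissible (X : Set (Torus K n)) : Prop :=
  IsAlgebraicSet X ∧
    (X.Finite ∨ (1 ≤ dim X ∧ ∀ C : Set (Torus K n), IsTorsionCoset C → C ⊆ X → dim C ≠ dim X))

/-- A hypersurface: the zero locus of a Laurent polynomial that is neither zero nor a unit. -/
def IsHypersurface (X : Set (Torus K n)) : Prop :=
  ∃ P : LaurentRing K n, P ≠ 0 ∧ ¬ IsUnit P ∧ X = zeroLocus P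

/-- The set `X_T` of points of `X` of finite order at most `T`. -/
def torsionUpTo (X : Set (Torus K n)) (T : ℝ) : Set (Torus K n) :=
  {ζ ∈ X | IsOfFinOrder ζ ∧ (orderOf ζ : ℝ) ≤ T}

end Torus

/-! Fix a torsion point `ζ` of order `N ≤ T` in a torus with character lattice `L` of rank `n`. The
pigeonhole principle applied to the exponents of `ζ` gives a nonzero linear form `g • b` on `L` with
`b` primitive and coefficients at most `T ^ (1 - 1 / n)`, such that the class of `ζ` modulo the
one-parameter subgroup defined by `b` is killed by `g`. If the translate of this subgroup by `ζ` is
not contained in `X`, it meets `X` in few points, and summing over `b` and `g` bounds the number of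
such `ζ`. The remaining `ζ` lie in finitely many subsets of `X`, one for each way of grouping the
monomials of the equations of `X` by the value of `b`, which are preimages of algebraic subsets of
an `n - 1`-dimensional torus; these inherit the absence of torsion cosets of codimension one, so
that induction applies. -/

open Asymptotics Filter Module

section TorsionPoints

variable {G H : Type*} [Monoid G] [Monoid H]

/-- The elements of a subset `X` of a monoid that have finite order at most `T`: the set `X_T` for
integral `T`, in an abstract group. -/
def torsionPoints (X : Set G) (T : ℕ) : Set G := {x ∈ X | IsOfFinOrder x ∧ orderOf x ≤ T}

/-- The number of pairs `(j, x)` with `0 < j` and `x ∈ X` of finite order such that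
`j * orderOf x ≤ T`. Unlike the number of torsion points alone, this controls the torsion points of
a preimage in a torus of one dimension more. -/
noncomputable def torsionWeight (X : Set G) (T : ℕ) : ℕ :=
  ∑ j ∈ Finset.Icc 1 T, (torsionPoints X (T / j)).ncard

theorem image_torsionPoints (e : G ≃* H) (X : Set G) (T : ℕ) :
    e '' torsionPoints X T = torsionPoints (e '' X) T := by
  ext y
  obtain ⟨x, rfl⟩ := e.surjective y
  simp only [torsionPoints, Set.mem_ofPred_eq, e.injective.mem_set_image, ← orderOf_pos_iff,
    MulEquiv.orderOf_eq]

theorem ncard_torsionPoints_le_torsionWeight (X : Set G) (T : ℕ) :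
    (torsionPoints X T).ncard ≤ torsionWeight X T := by
  rcases T.eq_zero_or_pos with rfl | hT
  · have : torsionPoints X 0 = ∅ :=
      Set.eq_empty_of_forall_notMem fun x hx => (hx.2.1.orderOf_pos.trans_le hx.2.2).false
    simp [this]
  · simpa [torsionWeight] using Finset.single_le_sum (f := fun j => (torsionPoints X (T / j)).ncard)
      (fun _ _ => Nat.zero_le _) (Finset.mem_Icc.2 ⟨le_rfl, hT⟩)

end TorsionPoints

section Asymptotics

theorem isBigO_rpow_rpow_atTop {α β : ℝ} (h : α ≤ β) :
    (fun T : ℕ => (T : ℝ) ^ α) =O[atTop] fun T : ℕ => (T : ℝ) ^ β := by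
  refine IsBigO.of_bound 1 ((eventually_ge_atTop 1).mono fun T hT => ?_)
  rw [one_mul, Real.norm_of_nonneg (by positivity), Real.norm_of_nonneg (by positivity)]
  exact Real.rpow_le_rpow_of_exponent_le (by exact_mod_cast hT) h

theorem isBigO_sum_Icc_div {N : ℕ → ℕ} {α : ℝ} (hα : 1 < α)
    (hN : (fun T => (N T : ℝ)) =O[atTop] fun T : ℕ => (T : ℝ) ^ α) :
    (fun T => ((∑ j ∈ Finset.Icc 1 T, N (T / j) : ℕ) : ℝ)) =O[atTop]
      fun T : ℕ => (T : ℝ) ^ α := by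
  obtain ⟨C, hC, hNC⟩ := bound_of_isBigO_nat_atTop hN
  have hsum : Summable fun j : ℕ => 1 / (j : ℝ) ^ α := Real.summable_one_div_nat_rpow.2 hα
  refine IsBigO.of_bound (C * ∑' j : ℕ, 1 / (j : ℝ) ^ α) (Eventually.of_forall fun T => ?_)
  have hterm : ∀ j ∈ Finset.Icc 1 T, (N (T / j) : ℝ) ≤ C * (T : ℝ) ^ α * (1 / (j : ℝ) ^ α) := by
    intro j hj
    obtain ⟨hj1, hjT⟩ := Finset.mem_Icc.1 hj
    have hdiv : (0 : ℝ) < (T / j : ℕ) := by exact_mod_cast Nat.div_pos hjT hj1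
    have hle : (N (T / j) : ℝ) ≤ C * ((T / j : ℕ) : ℝ) ^ α := by
      simpa [Real.norm_of_nonneg (Real.rpow_nonneg hdiv.le α)] using
        hNC (x := T / j) (Real.rpow_pos_of_pos hdiv α).ne'
    calc (N (T / j) : ℝ) ≤ C * ((T : ℝ) / j) ^ α := by
          grw [hle, Nat.cast_div_le]
      _ = C * (T : ℝ) ^ α * (1 / (j : ℝ) ^ α) := by
          rw [Real.div_rpow (by positivity) (by positivity)]; ring
  rw [Real.norm_of_nonneg (by positivity), Real.norm_of_nonneg (by positivity), Nat.cast_sum]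
  calc ∑ j ∈ Finset.Icc 1 T, (N (T / j) : ℝ)
      ≤ C * (T : ℝ) ^ α * ∑ j ∈ Finset.Icc 1 T, 1 / (j : ℝ) ^ α := by
        rw [Finset.mul_sum]; exact Finset.sum_le_sum hterm
    _ ≤ C * (T : ℝ) ^ α * ∑' j : ℕ, 1 / (j : ℝ) ^ α := by
        gcongr; exact hsum.sum_le_tsum _ fun j _ => by positivity
    _ = (C * ∑' j : ℕ, 1 / (j : ℝ) ^ α) * (T : ℝ) ^ α := by ring

theorem sub_one_div_nonneg {n : ℕ} (hn : 1 ≤ n) : 0 ≤ (n : ℝ) - 1 / n :=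
  sub_nonneg.2 ((one_div (n : ℝ)).trans_le (Nat.cast_inv_le_one n) |>.trans (by exact_mod_cast hn))

theorem lt_floor_rpow_add_one_pow {n : ℕ} (hn : 1 ≤ n) (T : ℕ) :
    T ^ (n - 1) < (⌊(T : ℝ) ^ (1 - 1 / (n : ℝ))⌋₊ + 1) ^ n := by
  have hpow : ((T : ℝ) ^ (1 - 1 / (n : ℝ))) ^ n = (T : ℝ) ^ (n - 1) := by
    rw [← Real.rpow_natCast, ← Real.rpow_mul (by positivity), ← Real.rpow_natCast, Nat.cast_sub hn]
    congr 1
    field_simp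
    simp
  have hlt : (T : ℝ) ^ (n - 1) < ((⌊(T : ℝ) ^ (1 - 1 / (n : ℝ))⌋₊ : ℝ) + 1) ^ n :=
    hpow ▸ pow_lt_pow_left₀ (Nat.lt_floor_add_one _) (by positivity) (by lia)
  exact_mod_cast hlt

theorem floor_rpow_pow_le {n : ℕ} (hn : 1 ≤ n) (T : ℕ) :
    (⌊(T : ℝ) ^ (1 - 1 / (n : ℝ))⌋₊ : ℝ) ^ (n + 1) ≤ (T : ℝ) ^ ((n : ℝ) - 1 / n) := by
  refine (pow_le_pow_left₀ (by positivity) (Nat.floor_le (by positivity)) _).trans_eq ?_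
  rw [← Real.rpow_natCast, ← Real.rpow_mul (by positivity)]
  congr 1
  push_cast
  field_simp
  ring

theorem sum_Icc_box_mul_le {n : ℕ} (hn : 1 ≤ n) (A B : ℕ) :
    ((∑ g ∈ Finset.Icc 1 B, (2 * (B / g) + 1) ^ n * (g ^ (n - 1) * (2 * (A * (B / g)))) : ℕ) : ℝ) ≤
      (2 * A * 3 ^ n * ∑' g : ℕ, 1 / (g : ℝ) ^ 2) * (B : ℝ) ^ (n + 1) := by
  have hsum : Summable fun g : ℕ => 1 / (g : ℝ) ^ 2 := Real.summable_one_div_nat_pow.2 one_lt_two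
  have hterm : ∀ g ∈ Finset.Icc 1 B,
      (2 * ((B / g : ℕ) : ℝ) + 1) ^ n * ((g : ℝ) ^ (n - 1) * (2 * (A * ((B / g : ℕ) : ℝ)))) ≤
        2 * A * 3 ^ n * (B : ℝ) ^ (n + 1) * (1 / (g : ℝ) ^ 2) := by
    intro g hg
    obtain ⟨hg1, hgB⟩ := Finset.mem_Icc.1 hg
    have hdiv : ((B / g : ℕ) : ℝ) ≤ B / g := Nat.cast_div_le
    have hone : (1 : ℝ) ≤ ((B / g : ℕ) : ℝ) := by exact_mod_cast (Nat.one_le_div_iff hg1).2 hgB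
    calc _ ≤ (3 * ((B : ℝ) / g)) ^ n * ((g : ℝ) ^ (n - 1) * (2 * (A * ((B : ℝ) / g)))) := by
          gcongr; linarith
      _ = 2 * A * 3 ^ n * (B : ℝ) ^ (n + 1) * (1 / (g : ℝ) ^ 2) := by
          obtain ⟨k, rfl⟩ := Nat.exists_eq_add_of_le' hn
          simp only [Nat.add_sub_cancel, mul_pow, div_pow]
          field_simp
          ring
  push_cast
  calc _ ≤ 2 * A * 3 ^ n * (B : ℝ) ^ (n + 1) * ∑ g ∈ Finset.Icc 1 B, 1 / (g : ℝ) ^ 2 := by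
        rw [Finset.mul_sum]; exact Finset.sum_le_sum hterm
    _ ≤ 2 * A * 3 ^ n * (B : ℝ) ^ (n + 1) * ∑' g : ℕ, 1 / (g : ℝ) ^ 2 := by
        gcongr; exact hsum.sum_le_tsum _ fun g _ => by positivity
    _ = _ := by ring

end Asymptotics

section Counting

theorem encard_le_mul_of_fibre {α β : Type*} {s : Set α} {t : Set β} {φ : α → β} {m k : ℕ}
    (hst : Set.MapsTo φ s t) (ht : t.encard ≤ m)
    (hfib : ∀ y ∈ t, {x ∈ s | φ x = y}.encard ≤ k) : s.encard ≤ (m * k : ℕ) := by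
  obtain ⟨htfin, htcard⟩ := Set.encard_le_coe_iff_finite_ncard_le.1 ht
  have hsub : s ⊆ ⋃ y ∈ htfin.toFinset, {x ∈ s | φ x = y} := fun x hx =>
    Set.mem_biUnion (htfin.mem_toFinset.2 (hst hx)) ⟨hx, rfl⟩
  calc s.encard ≤ ∑ y ∈ htfin.toFinset, {x ∈ s | φ x = y}.encard :=
        (Set.encard_le_encard hsub).trans (Finset.set_encard_biUnion_le _ _)
    _ ≤ ∑ _y ∈ htfin.toFinset, (k : ℕ∞) :=
        Finset.sum_le_sum fun _ hy => hfib _ (htfin.mem_toFinset.1 hy)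
    _ = (t.ncard * k : ℕ) := by
        rw [Finset.sum_const, nsmul_eq_mul, ← Set.ncard_eq_toFinset_card t htfin, Nat.cast_mul]
    _ ≤ (m * k : ℕ) := by gcongr

theorem exists_polynomial_eval_eq_sum_zpow {K : Type*} [Field K] {s : Finset ℤ} {H : ℕ}
    (hs : ∀ m ∈ s, m.natAbs ≤ H) {c : ℤ → K} (hc : ∃ m ∈ s, c m ≠ 0) :
    ∃ Q : Polynomial K, Q ≠ 0 ∧ Q.natDegree ≤ 2 * H ∧
      ∀ u : Kˣ, Q.eval (u : K) = (u : K) ^ H * ∑ m ∈ s, c m * (u : K) ^ m := by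
  obtain ⟨m₀, hm₀, hcm₀⟩ := hc
  refine ⟨∑ m ∈ s, Polynomial.C (c m) * Polynomial.X ^ (m + H).toNat, fun hQ => hcm₀ ?_, ?_,
    fun u => ?_⟩
  · have hshift : ∀ m ∈ s, (m₀ + H).toNat = (m + H).toNat ↔ m₀ = m := fun m hm => by
      have := hs m hm
      have := hs m₀ hm₀
      lia
    have hcoeff := congrArg (Polynomial.coeff · (m₀ + H).toNat) hQ
    simp only [Polynomial.finsetSum_coeff, Polynomial.coeff_C_mul_X_pow,
      Polynomial.coeff_zero] at hcoeff
    rwa [Finset.sum_congr rfl fun m hm => if_congr (hshift m hm) rfl rfl, Finset.sum_ite_eq,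
      if_pos hm₀] at hcoeff
  · refine Polynomial.natDegree_sum_le_of_forall_le _ _ fun m hm => ?_
    refine (Polynomial.natDegree_C_mul_X_pow_le _ _).trans ?_
    have := hs m hm
    lia
  · rw [Polynomial.eval_finsetSum, Finset.mul_sum]
    refine Finset.sum_congr rfl fun m hm => ?_
    have hnonneg : 0 ≤ m + H := by
      have := hs m hm
      lia
    have hpow : (u : K) ^ (m + H).toNat = (u : K) ^ m * (u : K) ^ H := by
      rw [← zpow_natCast, Int.toNat_of_nonneg hnonneg, zpow_add₀ u.ne_zero, zpow_natCast]
    simp only [Polynomial.eval_mul, Polynomial.eval_C, Polynomial.eval_pow, Polynomial.eval_X, hpow]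
    ring

theorem encard_sum_zpow_eq_zero_le {K : Type*} [Field K] {s : Finset ℤ} {H : ℕ}
    (hs : ∀ m ∈ s, m.natAbs ≤ H) {c : ℤ → K} (hc : ∃ m ∈ s, c m ≠ 0) :
    {u : Kˣ | ∑ m ∈ s, c m * (u : K) ^ m = 0}.encard ≤ (2 * H : ℕ) := by
  classical
  obtain ⟨Q, hQ, hdeg, heval⟩ := exists_polynomial_eval_eq_sum_zpow hs hc
  have hmaps : Set.MapsTo (fun u : Kˣ => (u : K)) {u | ∑ m ∈ s, c m * (u : K) ^ m = 0}
      ↑Q.roots.toFinset := by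
    intro u (hu : ∑ m ∈ s, c m * (u : K) ^ m = 0)
    rw [SetLike.mem_coe, Multiset.mem_toFinset, Polynomial.mem_roots hQ, Polynomial.IsRoot.def,
      heval, hu, mul_zero]
  refine (Set.encard_le_encard_of_injOn hmaps Units.val_injective.injOn).trans ?_
  rw [Set.encard_coe_eq_coe_finsetCard, Nat.cast_le]
  exact (Multiset.toFinset_card_le _).trans ((Polynomial.card_roots' Q).trans hdeg)

end Counting

section Lattice

theorem exists_zpow_eq_zpow {ι μ : Type*} [Fintype ι] [CommGroup μ] [Finite μ] (ω : μ) (z : ι → μ)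
    {B : ℕ} (hB : Nat.card μ ^ Fintype.card ι < orderOf z * (B + 1) ^ Fintype.card ι) :
    ∃ (t : ℤ) (β : ι → ℤ), β ≠ 0 ∧ (∀ i, (β i).natAbs ≤ B) ∧ ∀ i, ω ^ β i = z i ^ t := by
  let F : (ι → Fin (B + 1)) → (ι → μ) ⧸ Subgroup.zpowers z :=
    fun v => QuotientGroup.mk fun i => ω ^ (v i : ℕ)
  have hcard : Nat.card ((ι → μ) ⧸ Subgroup.zpowers z) < Nat.card (ι → Fin (B + 1)) := by
    have hmul := Subgroup.card_eq_card_quotient_mul_card_subgroup (Subgroup.zpowers z)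
    rw [Nat.card_zpowers, Nat.card_fun, Nat.card_eq_fintype_card (α := ι), mul_comm] at hmul
    rw [hmul] at hB
    exact (lt_of_mul_lt_mul_left hB (Nat.zero_le _)).trans_eq (by simp [Nat.card_fun])
  obtain ⟨v, w, hvw, hne⟩ : ∃ v w, F v = F w ∧ v ≠ w := by
    by_contra! h
    exact hcard.not_ge (Nat.card_le_card_of_injective F fun v w => h v w)
  obtain ⟨t, ht⟩ := Subgroup.mem_zpowers_iff.1 (QuotientGroup.eq.1 hvw)
  refine ⟨t, fun i => (w i : ℤ) - v i, fun h => hne (funext fun i => Fin.ext ?_), fun i => ?_,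
    fun i => ?_⟩
  · have := congrFun h i
    simp only [Pi.zero_apply] at this
    lia
  · have hv := (v i).is_lt
    have hw := (w i).is_lt
    lia
  · have := congrFun ht i
    simp only [Pi.pow_apply, Pi.mul_apply, Pi.inv_apply] at this
    rw [this, zpow_sub, zpow_natCast, zpow_natCast, mul_comm]

theorem gcd_orderOf_dvd_of_zpow_eq_zpow {G : Type*} [Group G] {ω z : G} (hω : IsOfFinOrder ω)
    (hz : z ^ orderOf ω = 1) {m t : ℤ} (h : ω ^ m = z ^ t) : (Int.gcd t (orderOf ω) : ℤ) ∣ m := by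
  obtain ⟨N', hN'⟩ : (Int.gcd t (orderOf ω) : ℤ) ∣ orderOf ω := Int.gcd_dvd_right ..
  obtain ⟨t', ht'⟩ : (Int.gcd t (orderOf ω) : ℤ) ∣ t := Int.gcd_dvd_left ..
  have hpow : ω ^ (m * N') = 1 := by
    rw [zpow_mul, h, ← zpow_mul, show t * N' = orderOf ω * t' by grind, zpow_mul, zpow_natCast, hz,
      one_zpow]
  have hN'0 : N' ≠ 0 := by
    rintro rfl
    exact hω.orderOf_pos.ne' (by exact_mod_cast hN'.trans (mul_zero _))
  refine Int.dvd_of_mul_dvd_mul_right hN'0 ?_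
  rw [← hN']
  exact orderOf_dvd_iff_zpow_eq_one.2 hpow

variable {L : Type*} [AddCommGroup L]

theorem exists_eq_smul_of_ne_zero {β : L →ₗ[ℤ] ℤ} (hβ : β ≠ 0) :
    ∃ (d : ℤ) (b : L →ₗ[ℤ] ℤ) (f : L), b f = 1 ∧ β = d • b := by
  obtain ⟨d, hd⟩ := (IsPrincipalIdealRing.principal (LinearMap.range β)).principal
  have hdvd : ∀ a, d ∣ β a := fun a => by
    rw [← Ideal.mem_span_singleton, Ideal.span, ← hd]
    exact LinearMap.mem_range_self β a
  have hd0 : d ≠ 0 := by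
    rintro rfl
    exact hβ (LinearMap.ext fun a => zero_dvd_iff.1 (hdvd a))
  obtain ⟨f, hf⟩ : d ∈ LinearMap.range β := hd ▸ Submodule.mem_span_singleton_self d
  let b : L →ₗ[ℤ] ℤ := AddMonoidHom.toIntLinearMap
    { toFun := fun a => β a / d
      map_zero' := by simp
      map_add' := fun a a' => by rw [map_add, Int.add_ediv_of_dvd_left (hdvd a)] }
  refine ⟨d, b, f, ?_, LinearMap.ext fun a => (Int.mul_ediv_cancel' (hdvd a)).symm⟩
  change β f / d = 1
  rw [hf, Int.ediv_self hd0]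

theorem natAbs_apply_le {ι : Type*} [Fintype ι] (e : Basis ι ℤ L) (b : L →ₗ[ℤ] ℤ) {k : ℕ}
    (hb : ∀ i, (b (e i)).natAbs ≤ k) (a : L) :
    (b a).natAbs ≤ (∑ i, (e.repr a i).natAbs) * k := by
  conv_lhs => rw [← e.sum_repr a, map_sum]
  rw [Finset.sum_mul]
  refine (Int.natAbs_sum_le _ _).trans (Finset.sum_le_sum fun i _ => ?_)
  rw [map_smul, smul_eq_mul, Int.natAbs_mul]
  exact Nat.mul_le_mul_left _ (hb i)

theorem exists_finset_forms {ι : Type*} [Fintype ι] (e : Basis ι ℤ L) (k : ℕ) :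
    ∃ F : Finset (L →ₗ[ℤ] ℤ), F.card = (2 * k + 1) ^ Fintype.card ι ∧
      ∀ b, b ∈ F ↔ ∀ i, (b (e i)).natAbs ≤ k := by
  classical
  refine ⟨(Fintype.piFinset fun _ : ι => Finset.Icc (-(k : ℤ)) k).map
    (e.constr ℤ).toEquiv.toEmbedding, ?_, fun b => ?_⟩
  · rw [Finset.card_map, Fintype.card_piFinset, Finset.prod_const, Int.card_Icc, Finset.card_univ]
    congr 1
    lia
  · rw [Finset.mem_map_equiv, Fintype.mem_piFinset]
    refine forall_congr' fun i => ?_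
    change b (e i) ∈ Finset.Icc (-(k : ℤ)) k ↔ _
    rw [Finset.mem_Icc]
    lia

/-- The projection of `L` onto the kernel of the form `b` along a vector `f` with `b f = 1`. -/
def projKer (b : L →ₗ[ℤ] ℤ) (f : L) (hf : b f = 1) : L →ₗ[ℤ] LinearMap.ker b :=
  LinearMap.codRestrict (LinearMap.ker b) (LinearMap.id - b.smulRight f) fun a => by simp [hf]

variable {b : L →ₗ[ℤ] ℤ} {f : L}

theorem coe_projKer (hf : b f = 1) (a : L) : (projKer b f hf a : L) = a - b a • f := rfl

theorem projKer_coe (hf : b f = 1) (k : LinearMap.ker b) : projKer b f hf k = k :=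
  Subtype.ext (by rw [coe_projKer, LinearMap.mem_ker.1 k.2, zero_smul, sub_zero])

theorem finrank_ker_add_one [Module.Free ℤ L] [Module.Finite ℤ L] (hf : b f = 1) :
    finrank ℤ (LinearMap.ker b) + 1 = finrank ℤ L := by
  have hsurj : Function.Surjective b := fun m => ⟨m • f, by simp [hf]⟩
  rw [← Submodule.finrank_quotient_add_finrank (LinearMap.ker b),
    (b.quotKerEquivOfSurjective hsurj).finrank_eq, Module.finrank_self, add_comm]

end Lattice

/-- The `K`-points of the algebraic torus with character lattice `L`, that is the homomorphisms
from `L` to `Kˣ`. For `L = ℤ^n` it is `𝔾_m^n`; abstract lattices are needed because the induction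
on the dimension passes to the kernel of a linear form on `L`. -/
abbrev CharTorus (K L : Type*) [Field K] [AddCommGroup L] : Type _ := AddChar L Kˣ

namespace CharTorus

variable {K L M : Type*} [Field K] [AddCommGroup L] [AddCommGroup M]

section Torsion

theorem ext_of_basis {ι : Type*} (e : Basis ι ℤ L) {x y : CharTorus K L}
    (h : ∀ i, x (e i) = y (e i)) : x = y := by
  have hlin : x.toAddMonoidHom.toIntLinearMap = y.toAddMonoidHom.toIntLinearMap :=
    e.ext fun i => congrArg Additive.ofMul (h i)
  exact DFunLike.ext x y fun a => congrArg Additive.toMul (LinearMap.congr_fun hlin a)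

theorem encard_pow_eq_one_le [Module.Free ℤ L] [Module.Finite ℤ L] (g : ℕ) [NeZero g] :
    {x : CharTorus K L | x ^ g = 1}.encard ≤ (g ^ finrank ℤ L : ℕ) := by
  let e := finBasis ℤ L
  let coord : {x : CharTorus K L | x ^ g = 1} → Fin (finrank ℤ L) → rootsOfUnity g K :=
    fun x i => ⟨x.1 (e i), by
      rw [mem_rootsOfUnity, ← AddChar.pow_apply, x.2, AddChar.one_apply]⟩
  have hcoord : Function.Injective coord := fun _ _ h =>
    Subtype.ext (ext_of_basis e fun i => congrArg Subtype.val (congrFun h i))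
  refine (ENat.card_le_card_of_injective hcoord).trans ?_
  rw [ENat.card_eq_coe_natCard, Nat.card_fun, Nat.card_fin, Nat.cast_le]
  exact Nat.pow_le_pow_left (card_rootsOfUnity K g) _

theorem finite_torsionPoints [Module.Free ℤ L] [Module.Finite ℤ L] (X : Set (CharTorus K L))
    (T : ℕ) : (torsionPoints X T).Finite := by
  have hfin : (⋃ N ∈ Finset.Icc 1 T, {x : CharTorus K L | x ^ N = 1}).Finite := by
    refine (Finset.finite_toSet _).biUnion fun N hN => ?_
    have : NeZero N := ⟨by have := (Finset.mem_Icc.1 hN).1; lia⟩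
    exact Set.finite_of_encard_le_coe (encard_pow_eq_one_le N)
  refine hfin.subset fun ζ ⟨_, hζ, hζT⟩ => ?_
  exact Set.mem_biUnion (Finset.mem_Icc.2 ⟨hζ.orderOf_pos, hζT⟩) (pow_orderOf_eq_one ζ)

end Torsion

section Pullback

/-- The homomorphism of tori that is dual to a homomorphism of character lattices. -/
def pullback (p : M →ₗ[ℤ] L) : CharTorus K L →* CharTorus K M where
  toFun x := x.compAddMonoidHom p.toAddMonoidHom
  map_one' := rfl
  map_mul' _ _ := rfl

@[simp] theorem pullback_apply (p : M →ₗ[ℤ] L) (x : CharTorus K L) (a : M) :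
    pullback p x a = x (p a) := rfl

/-- The restriction of characters of `L` to the kernel of a linear form `b`: the quotient of the
torus by the one-parameter subgroup that `b` defines. -/
def resKer (b : L →ₗ[ℤ] ℤ) : CharTorus K L →* CharTorus K (LinearMap.ker b) :=
  pullback (LinearMap.ker b).subtype

@[simp] theorem resKer_apply (b : L →ₗ[ℤ] ℤ) (x : CharTorus K L) (k : LinearMap.ker b) :
    resKer b x k = x k := rfl

variable {b : L →ₗ[ℤ] ℤ} {f : L}

theorem eq_of_resKer_eq (hf : b f = 1) {x y : CharTorus K L} (hker : resKer b x = resKer b y)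
    (hxy : x f = y f) : x = y := by
  refine DFunLike.ext _ _ fun a => ?_
  have ha : a = (projKer b f hf a : L) + b a • f := by simp [coe_projKer]
  rw [ha, AddChar.map_add_eq_mul, AddChar.map_add_eq_mul, AddChar.map_zsmul_eq_zpow,
    AddChar.map_zsmul_eq_zpow, hxy, ← resKer_apply, hker, resKer_apply]

theorem injOn_apply_of_resKer_eq (hf : b f = 1) (y : CharTorus K (LinearMap.ker b)) :
    Set.InjOn (fun x : CharTorus K L => x f) {x | resKer b x = y} :=
  fun _ hx _ hx' => eq_of_resKer_eq hf (hx.trans hx'.symm)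

end Pullback

section Components

/-- The value at `x` of the Laurent polynomial `∑ P a * X ^ a` with exponents in `L`. -/
noncomputable def charEval (x : CharTorus K L) : (L →₀ K) →ₗ[K] K :=
  Finsupp.linearCombination K fun a => (x a : K)

/-- The common zeros in the torus of a set of Laurent polynomials. -/
def vanishing (S : Set (L →₀ K)) : Set (CharTorus K L) := {x | ∀ P ∈ S, charEval x P = 0}

/-- The component of degree `m` of a Laurent polynomial, for the grading defined by the form
`b`. -/
noncomputable def component (b : L →ₗ[ℤ] ℤ) (m : ℤ) (P : L →₀ K) : L →₀ K :=
  P.filter fun a => b a = m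

/-- The components of the members of `S`, for the grading defined by `b`. Their common zeros are
the points whose translate of the one-parameter subgroup defined by `b` lies in `vanishing S`. -/
def components (S : Set (L →₀ K)) (b : L →ₗ[ℤ] ℤ) : Set (L →₀ K) :=
  {Q | ∃ P ∈ S, ∃ m, component b m P = Q}

/-- The component of degree `m` of `P` for the grading defined by `b`, divided by the monomial with
exponent `m • f`. For `b f = 1` it is a Laurent polynomial with exponents in the kernel of `b`. -/
noncomputable def slice (b : L →ₗ[ℤ] ℤ) (f : L) (m : ℤ) (P : L →₀ K) : LinearMap.ker b →₀ K :=
  P.comapDomain (fun k => (k : L) + m • f)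
    ((add_left_injective (m • f)).comp Subtype.val_injective).injOn

/-- The equations in the torus of `LinearMap.ker b` whose preimage under `resKer b` is cut out by
`components S b`. -/
def kerSystem (S : Set (L →₀ K)) (b : L →ₗ[ℤ] ℤ) (f : L) : Set (LinearMap.ker b →₀ K) :=
  {Q | ∃ P ∈ S, ∃ m, slice b f m P = Q}

variable {S : Set (L →₀ K)} {b : L →ₗ[ℤ] ℤ} {f : L}

theorem sum_component (b : L →ₗ[ℤ] ℤ) (P : L →₀ K) :
    ∑ m ∈ P.support.image b, component b m P = P := by
  ext a
  by_cases ha : P a = 0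
  · simp [component, Finsupp.finsetSum_apply, Finsupp.filter_apply, ha]
  · simp [component, Finsupp.finsetSum_apply, Finsupp.filter_apply,
      Finset.mem_image_of_mem b (Finsupp.mem_support_iff.2 ha)]

theorem component_eq_mapDomain_slice (hf : b f = 1) (m : ℤ) (P : L →₀ K) :
    component b m P = (slice b f m P).mapDomain fun k : LinearMap.ker b => (k : L) + m • f := by
  have hslice : slice b f m P = slice b f m (component b m P) :=
    Finsupp.ext fun k => by simp [slice, component, hf]
  rw [hslice, slice, Finsupp.mapDomain_comapDomain]
  · exact (add_left_injective (m • f)).comp Subtype.val_injective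
  · intro a ha
    have hba : b a = m := by
      by_contra hne
      exact Finsupp.mem_support_iff.1 ha (Finsupp.filter_apply_neg _ _ hne)
    exact ⟨⟨a - m • f, by simp [hba, hf]⟩, by simp⟩

theorem charEval_component (hf : b f = 1) (x : CharTorus K L) (m : ℤ) (P : L →₀ K) :
    charEval x (component b m P) = (x f : K) ^ m * charEval (resKer b x) (slice b f m P) := by
  rw [component_eq_mapDomain_slice hf, charEval, Finsupp.linearCombination_mapDomain, charEval,
    Finsupp.linearCombination_apply, Finsupp.linearCombination_apply, Finsupp.mul_sum]
  refine Finsupp.sum_congr fun k _ => ?_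
  simp only [Function.comp_apply, AddChar.map_add_eq_mul, AddChar.map_zsmul_eq_zpow, resKer_apply,
    Units.val_mul, Units.val_zpow_eq_zpow_val, smul_eq_mul]
  ring

theorem charEval_eq_sum_slice (hf : b f = 1) (x : CharTorus K L) (P : L →₀ K) :
    charEval x P =
      ∑ m ∈ P.support.image b, charEval (resKer b x) (slice b f m P) * (x f : K) ^ m := by
  conv_lhs => rw [← sum_component b P, map_sum]
  exact Finset.sum_congr rfl fun m _ => by rw [charEval_component hf, mul_comm]

theorem slice_eq_zero (hf : b f = 1) {m : ℤ} {P : L →₀ K} (hm : m ∉ P.support.image b) :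
    slice b f m P = 0 := by
  ext k
  by_contra hk
  exact hm (Finset.mem_image.2 ⟨k + m • f, Finsupp.mem_support_iff.2 hk, by simp [hf]⟩)

theorem vanishing_components_subset (S : Set (L →₀ K)) (b : L →ₗ[ℤ] ℤ) :
    vanishing (components S b) ⊆ vanishing S := by
  intro x hx P hP
  rw [← sum_component b P, map_sum]
  exact Finset.sum_eq_zero fun m _ => hx _ ⟨P, hP, m, rfl⟩

theorem vanishing_components_eq_preimage (S : Set (L →₀ K)) (hf : b f = 1) :
    vanishing (components S b) = resKer b ⁻¹' vanishing (kerSystem S b f) := by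
  ext x
  have hxf (m : ℤ) : (x f : K) ^ m ≠ 0 := zpow_ne_zero m (x f).ne_zero
  constructor
  · rintro hx _ ⟨P, hP, m, rfl⟩
    simpa [charEval_component hf, hxf] using hx _ ⟨P, hP, m, rfl⟩
  · rintro hx _ ⟨P, hP, m, rfl⟩
    rw [charEval_component hf, hx _ ⟨P, hP, m, rfl⟩, mul_zero]

theorem finite_kerSystem (hS : S.Finite) (hf : b f = 1) : (kerSystem S b f).Finite := by
  have hfin : (⋃ P ∈ S, insert 0 ((fun m => slice b f m P) '' ↑(P.support.image b))).Finite :=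
    hS.biUnion fun P _ => ((Finset.finite_toSet _).image _).insert 0
  refine hfin.subset ?_
  rintro _ ⟨P, hP, m, rfl⟩
  refine Set.mem_biUnion hP ?_
  by_cases hm : m ∈ P.support.image b
  · exact Or.inr ⟨m, hm, rfl⟩
  · exact Or.inl (slice_eq_zero hf hm)

theorem finite_range_vanishing_components (hS : S.Finite) :
    (Set.range fun b : L →ₗ[ℤ] ℤ => vanishing (components S b)).Finite := by
  classical
  have hfin : (⋃ P ∈ S, (fun A : Finset L => P.filter (· ∈ A)) '' ↑P.support.powerset).Finite :=
    hS.biUnion fun P _ => (Finset.finite_toSet _).image _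
  refine (hfin.finite_subsets.image vanishing).subset ?_
  rintro _ ⟨b, rfl⟩
  refine ⟨components S b, ?_, rfl⟩
  rintro _ ⟨P, hP, m, rfl⟩
  refine Set.mem_biUnion hP ⟨P.support.filter (b · = m),
    Finset.mem_coe.2 (Finset.mem_powerset.2 (Finset.filter_subset _ _)), ?_⟩
  ext a
  by_cases ha : P a = 0 <;> simp [component, Finsupp.filter_apply, ha]

end Components

section OneParameter

variable {S : Set (L →₀ K)} {b : L →ₗ[ℤ] ℤ} {f : L}

theorem encard_resKer_eq_le (hf : b f = 1) {H : ℕ}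
    (hH : ∀ P ∈ S, ∀ a ∈ P.support, (b a).natAbs ≤ H) (y : CharTorus K (LinearMap.ker b)) :
    {x ∈ vanishing S \ vanishing (components S b) | resKer b x = y}.encard ≤ (2 * H : ℕ) := by
  rcases Set.eq_empty_or_nonempty {x ∈ vanishing S \ vanishing (components S b) | resKer b x = y}
    with hempty | ⟨x₀, ⟨-, hx₀⟩, rfl⟩
  · rw [hempty, Set.encard_empty]
    exact zero_le
  obtain ⟨P, hP, m, hm⟩ : ∃ P ∈ S, ∃ m, charEval (resKer b x₀) (slice b f m P) ≠ 0 := by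
    rw [vanishing_components_eq_preimage S hf] at hx₀
    by_contra! h
    exact hx₀ fun _ ⟨P, hP, m, hQ⟩ => hQ ▸ h P hP m
  have hmP : m ∈ P.support.image b := by
    by_contra h
    exact hm (by rw [slice_eq_zero hf h, map_zero])
  have hdeg : ∀ m ∈ P.support.image b, m.natAbs ≤ H := by
    simpa only [Finset.forall_mem_image] using hH P hP
  refine (Set.encard_le_encard_of_injOn ?_ ((injOn_apply_of_resKer_eq hf _).mono fun _ hx => hx.2)
    ).trans (encard_sum_zpow_eq_zero_le hdeg
      (c := fun m => charEval (resKer b x₀) (slice b f m P)) ⟨m, hmP, hm⟩)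
  rintro x ⟨⟨hxS, -⟩, hx⟩
  rw [Set.mem_ofPred_eq, ← hx, ← charEval_eq_sum_slice hf]
  exact hxS P hP

theorem encard_resKer_pow_eq_one_le [Module.Free ℤ L] [Module.Finite ℤ L] (hf : b f = 1) {H : ℕ}
    (hH : ∀ P ∈ S, ∀ a ∈ P.support, (b a).natAbs ≤ H) (g : ℕ) [NeZero g] :
    {x ∈ vanishing S \ vanishing (components S b) | resKer b x ^ g = 1}.encard ≤
      (g ^ (finrank ℤ L - 1) * (2 * H) : ℕ) := by
  have hrank : finrank ℤ (LinearMap.ker b) = finrank ℤ L - 1 := by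
    rw [← finrank_ker_add_one hf, Nat.add_sub_cancel]
  refine encard_le_mul_of_fibre (φ := resKer b)
    (t := {y : CharTorus K (LinearMap.ker b) | y ^ g = 1}) (fun x hx => hx.2)
    (hrank ▸ encard_pow_eq_one_le g) fun y _ => ?_
  refine (Set.encard_le_encard ?_).trans (encard_resKer_eq_le hf hH y)
  exact fun x hx => ⟨hx.1.1, hx.2⟩

theorem ncard_torsionPoints_preimage_resKer_le [Module.Free ℤ L] [Module.Finite ℤ L]
    (hf : b f = 1) (Y : Set (CharTorus K (LinearMap.ker b))) (T : ℕ) :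
    (torsionPoints (resKer b ⁻¹' Y) T).ncard ≤ T * torsionWeight Y T := by
  let stratum (j : ℕ) : Set (CharTorus K L) :=
    {x | resKer b x ∈ torsionPoints Y (T / j) ∧ x f ^ (orderOf (resKer b x) * j) = 1}
  have hsub : torsionPoints (resKer b ⁻¹' Y) T ⊆ ⋃ j ∈ Finset.Icc 1 T, stratum j := by
    rintro ζ ⟨hζY, hζ, hζT⟩
    have hη : IsOfFinOrder (resKer b ζ) := MonoidHom.isOfFinOrder _ hζ
    obtain ⟨j, hj⟩ : orderOf (resKer b ζ) ∣ orderOf ζ := orderOf_map_dvd _ _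
    have hj0 : 0 < j := Nat.pos_of_ne_zero fun h => hζ.orderOf_pos.ne' (by rw [hj, h, mul_zero])
    have hjT : orderOf (resKer b ζ) * j ≤ T := hj ▸ hζT
    refine Set.mem_biUnion
      (Finset.mem_Icc.2 ⟨hj0, (Nat.le_mul_of_pos_left j hη.orderOf_pos).trans hjT⟩)
      ⟨⟨hζY, hη, (Nat.le_div_iff_mul_le hj0).2 hjT⟩, ?_⟩
    rw [← hj, ← AddChar.pow_apply, pow_orderOf_eq_one, AddChar.one_apply]
  have hlift : ∀ j ∈ Finset.Icc 1 T,
      (stratum j).Finite ∧ (stratum j).ncard ≤ (torsionPoints Y (T / j)).ncard * T := by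
    intro j hj
    have hj0 : 0 < j := (Finset.mem_Icc.1 hj).1
    rw [← Set.encard_le_coe_iff_finite_ncard_le]
    refine encard_le_mul_of_fibre (φ := resKer b) (fun x hx => hx.1)
      (finite_torsionPoints Y (T / j)).cast_ncard_eq.ge fun y ⟨_, hy, hyT⟩ => ?_
    have : NeZero (orderOf y * j) := ⟨(Nat.mul_pos hy.orderOf_pos hj0).ne'⟩
    refine (Set.encard_le_encard_of_injOn (t := (rootsOfUnity (orderOf y * j) K : Set Kˣ)) ?_
      ((injOn_apply_of_resKer_eq hf y).mono fun _ hx => hx.2)).trans ?_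
    · rintro x ⟨⟨-, hx⟩, rfl⟩
      exact (mem_rootsOfUnity _ _).2 hx
    · refine (ENat.card_eq_coe_natCard (rootsOfUnity (orderOf y * j) K)).trans_le ?_
      exact Nat.cast_le.2 ((card_rootsOfUnity K _).trans ((Nat.le_div_iff_mul_le hj0).1 hyT))
  calc _ ≤ (⋃ j ∈ Finset.Icc 1 T, stratum j).ncard :=
        Set.ncard_le_ncard hsub ((Finset.finite_toSet _).biUnion fun j hj => (hlift j hj).1)
    _ ≤ ∑ j ∈ Finset.Icc 1 T, (stratum j).ncard := Finset.set_ncard_biUnion_le _ _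
    _ ≤ ∑ j ∈ Finset.Icc 1 T, (torsionPoints Y (T / j)).ncard * T :=
        Finset.sum_le_sum fun j hj => (hlift j hj).2
    _ = T * torsionWeight Y T := by rw [torsionWeight, ← Finset.sum_mul, mul_comm]

end OneParameter

section Dirichlet

variable {ι : Type*} [Fintype ι] [Nonempty ι] (e : Basis ι ℤ L) {ζ : CharTorus K L} {B : ℕ}

theorem exists_form_zpow_eq (hζ : IsOfFinOrder ζ)
    (hB : orderOf ζ ^ (Fintype.card ι - 1) < (B + 1) ^ Fintype.card ι) :
    ∃ (ω : Kˣ) (t : ℤ) (β : L →ₗ[ℤ] ℤ), orderOf ω = orderOf ζ ∧ β ≠ 0 ∧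
      (∀ i, (β (e i)).natAbs ≤ B) ∧ ∀ a, ω ^ β a = ζ a ^ t := by
  have hN : 0 < orderOf ζ := hζ.orderOf_pos
  have : NeZero (orderOf ζ) := ⟨hN.ne'⟩
  let z (i : ι) : rootsOfUnity (orderOf ζ) K :=
    ⟨ζ (e i), by rw [mem_rootsOfUnity, ← AddChar.pow_apply, pow_orderOf_eq_one, AddChar.one_apply]⟩
  have hz : orderOf z = orderOf ζ := orderOf_eq_orderOf_iff.2 fun k =>
    ⟨fun h => ext_of_basis e fun i => congrArg Subtype.val (congrFun h i),
      fun h => funext fun i => Subtype.ext (DFunLike.congr_fun h (e i))⟩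
  have hcard : Nat.card (rootsOfUnity (orderOf ζ) K) = orderOf ζ := by
    refine (card_rootsOfUnity K _).antisymm (Nat.le_of_dvd Nat.card_pos ?_)
    exact hz.symm.dvd.trans (orderOf_dvd_of_pow_eq_one (funext fun i => pow_card_eq_one'))
  obtain ⟨ω, hω⟩ := IsCyclic.exists_generator (α := rootsOfUnity (orderOf ζ) K)
  have hpigeon : Nat.card (rootsOfUnity (orderOf ζ) K) ^ Fintype.card ι <
      orderOf z * (B + 1) ^ Fintype.card ι := by
    rw [hcard, hz, ← mul_pow_sub_one Fintype.card_ne_zero]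
    exact Nat.mul_lt_mul_of_pos_left hB hN
  obtain ⟨t, β, hβ, hβB, hβz⟩ := exists_zpow_eq_zpow ω z hpigeon
  obtain ⟨b, hb⟩ : ∃ b : L →ₗ[ℤ] ℤ, ∀ i, b (e i) = β i :=
    ⟨e.constr ℤ β, fun i => e.constr_basis ℤ β i⟩
  refine ⟨ω, t, b, ?_, fun h => hβ (funext fun i => ?_), fun i => hb i ▸ hβB i, fun a => ?_⟩
  · rw [Subgroup.orderOf_coe, orderOf_eq_card_of_forall_mem_zpowers hω, hcard]
  · rw [← hb, h, LinearMap.zero_apply, Pi.zero_apply]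
  · let χ : CharTorus K L :=
      { toFun := fun a => (ω : Kˣ) ^ b a
        map_zero_eq_one' := by rw [map_zero, zpow_zero]
        map_add_eq_mul' := fun a a' => by rw [map_add, zpow_add] }
    have hχ : χ = ζ ^ t := ext_of_basis e fun i => by
      rw [AddChar.zpow_apply]
      exact (congrArg ((ω : Kˣ) ^ ·) (hb i)).trans (congrArg Subtype.val (hβz i))
    rw [← AddChar.zpow_apply, ← hχ]
    rfl

theorem exists_resKer_pow_eq_one (hζ : IsOfFinOrder ζ)
    (hB : orderOf ζ ^ (Fintype.card ι - 1) < (B + 1) ^ Fintype.card ι) :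
    ∃ (g : ℕ) (b : L →ₗ[ℤ] ℤ), 0 < g ∧ (∃ f, b f = 1) ∧ resKer b ζ ^ g = 1 ∧
      ∀ i, g * (b (e i)).natAbs ≤ B := by
  obtain ⟨ω, t, β, hω, hβ, hβB, hβζ⟩ := exists_form_zpow_eq e hζ hB
  obtain ⟨d, b, f, hf, rfl⟩ := exists_eq_smul_of_ne_zero hβ
  have hζN (a : L) : ζ a ^ orderOf ζ = 1 := by
    rw [← AddChar.pow_apply, pow_orderOf_eq_one, AddChar.one_apply]
  have hd : (Int.gcd t (orderOf ζ) : ℤ) ∣ d := by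
    have hωf : ω ^ d = ζ f ^ t := by simpa [hf] using hβζ f
    rw [← hω]
    exact gcd_orderOf_dvd_of_zpow_eq_zpow (orderOf_pos_iff.1 (hω ▸ hζ.orderOf_pos))
      (hω ▸ hζN f) hωf
  refine ⟨Int.gcd t (orderOf ζ), b, Int.gcd_pos_of_ne_zero_right _ ?_, ⟨f, hf⟩, ?_, fun i => ?_⟩
  · exact_mod_cast hζ.orderOf_pos.ne'
  · refine DFunLike.ext _ _ fun k => ?_
    have hkt : ζ k ^ t = 1 := by
      rw [← hβζ, LinearMap.smul_apply, LinearMap.mem_ker.1 k.2, smul_zero, zpow_zero]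
    rw [AddChar.pow_apply, AddChar.one_apply, resKer_apply, ← orderOf_dvd_iff_pow_eq_one,
      ← Int.natCast_dvd_natCast]
    exact Int.dvd_coe_gcd (orderOf_dvd_iff_zpow_eq_one.2 hkt)
      (Int.natCast_dvd_natCast.2 (orderOf_dvd_of_pow_eq_one (hζN k)))
  · have hd0 : d ≠ 0 := fun h => hβ (by rw [h, zero_smul])
    calc Int.gcd t (orderOf ζ) * (b (e i)).natAbs ≤ d.natAbs * (b (e i)).natAbs :=
          Nat.mul_le_mul_right _ (Nat.le_of_dvd (Int.natAbs_pos.2 hd0) (Int.natCast_dvd.1 hd))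
      _ = ((d • b) (e i)).natAbs := by
          rw [LinearMap.smul_apply, smul_eq_mul, Int.natAbs_mul]
      _ ≤ B := hβB i

end Dirichlet

section CosetFree

variable {S : Set (L →₀ K)}

/-- The zeros of `S` that lie on no translate of a one-dimensional subtorus consisting of zeros
of `S`. -/
def cosetFreePart (S : Set (L →₀ K)) : Set (CharTorus K L) :=
  {x ∈ vanishing S | ∀ b f, b f = 1 → x ∉ vanishing (components S b)}

theorem exists_natAbs_apply_support_le {ι : Type*} [Finite ι] (e : Basis ι ℤ L) (hS : S.Finite) :
    ∃ A : ℕ, ∀ (b : L →ₗ[ℤ] ℤ) (k : ℕ), (∀ i, (b (e i)).natAbs ≤ k) →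
      ∀ P ∈ S, ∀ a ∈ P.support, (b a).natAbs ≤ A * k := by
  have := Fintype.ofFinite ι
  have hfin : (⋃ P ∈ S, (P.support : Set L)).Finite := hS.biUnion fun P _ => P.support.finite_toSet
  obtain ⟨A, hA⟩ := (hfin.image fun a => ∑ i, (e.repr a i).natAbs).bddAbove
  refine ⟨A, fun b k hb P hP a ha => (natAbs_apply_le e b hb a).trans (Nat.mul_le_mul_right k ?_)⟩
  exact hA (Set.mem_image_of_mem _ (Set.mem_biUnion hP ha))

theorem torsionPoints_cosetFreePart_subset {ι : Type*} [Fintype ι] [Nonempty ι] (e : Basis ι ℤ L)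
    {T B : ℕ} (hB : T ^ (Fintype.card ι - 1) < (B + 1) ^ Fintype.card ι) :
    torsionPoints (cosetFreePart S) T ⊆
      ⋃ g ∈ Finset.Icc 1 B, ⋃ b ∈ {b : L →ₗ[ℤ] ℤ | ∀ i, (b (e i)).natAbs ≤ B / g},
        {x ∈ vanishing S \ vanishing (components S b) | (∃ f, b f = 1) ∧ resKer b x ^ g = 1} := by
  rintro ζ ⟨⟨hζS, hζfree⟩, hζ, hζT⟩
  obtain ⟨g, b, hg, ⟨f, hf⟩, hbζ, hbB⟩ :=
    exists_resKer_pow_eq_one e hζ ((Nat.pow_le_pow_left hζT _).trans_lt hB)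
  have hgB : g ≤ B := by
    obtain ⟨i, hi⟩ : ∃ i, b (e i) ≠ 0 := by
      by_contra! h
      have hb : b = 0 := e.ext h
      simp [hb] at hf
    exact (Nat.le_mul_of_pos_right g (Int.natAbs_pos.2 hi)).trans (hbB i)
  refine Set.mem_biUnion (Finset.mem_Icc.2 ⟨hg, hgB⟩) (Set.mem_biUnion (x := b) (fun i => ?_)
    ⟨⟨hζS, hζfree b f hf⟩, ⟨f, hf⟩, hbζ⟩)
  exact (Nat.le_div_iff_mul_le hg).2 (mul_comm g _ ▸ hbB i)

theorem encard_torsionPoints_cosetFreePart_le {ι : Type*} [Fintype ι] [Nonempty ι]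
    (e : Basis ι ℤ L) {A : ℕ} (hA : ∀ (b : L →ₗ[ℤ] ℤ) (k : ℕ), (∀ i, (b (e i)).natAbs ≤ k) →
      ∀ P ∈ S, ∀ a ∈ P.support, (b a).natAbs ≤ A * k)
    {T B : ℕ} (hB : T ^ (Fintype.card ι - 1) < (B + 1) ^ Fintype.card ι) :
    (torsionPoints (cosetFreePart S) T).encard ≤
      (∑ g ∈ Finset.Icc 1 B, (2 * (B / g) + 1) ^ Fintype.card ι *
        (g ^ (Fintype.card ι - 1) * (2 * (A * (B / g)))) : ℕ) := by
  have := Module.Free.of_basis e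
  have := Module.Finite.of_basis e
  refine (Set.encard_le_encard (torsionPoints_cosetFreePart_subset e hB)).trans ?_
  rw [Nat.cast_sum]
  refine (Finset.set_encard_biUnion_le _ _).trans (Finset.sum_le_sum fun g hg => ?_)
  have : NeZero g := ⟨by have := (Finset.mem_Icc.1 hg).1; lia⟩
  obtain ⟨F, hFcard, hF⟩ := exists_finset_forms e (B / g)
  rw [show {b : L →ₗ[ℤ] ℤ | ∀ i, (b (e i)).natAbs ≤ B / g} = F from Set.ext fun b => (hF b).symm]
  refine (Finset.set_encard_biUnion_le _ _).trans ?_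
  rw [← hFcard, Nat.cast_mul, ← nsmul_eq_mul]
  refine Finset.sum_le_card_nsmul _ _ _ fun b hb => ?_
  by_cases hprim : ∃ f, b f = 1
  · obtain ⟨f, hf⟩ := hprim
    rw [← finrank_eq_card_basis e]
    refine (Set.encard_le_encard ?_).trans
      (encard_resKer_pow_eq_one_le hf (hA b _ ((hF b).1 hb)) g)
    exact fun x hx => ⟨hx.1, hx.2.2⟩
  · simp [hprim]

theorem isBigO_ncard_torsionPoints_cosetFreePart [Module.Free ℤ L] [Module.Finite ℤ L]
    (hL : 1 ≤ finrank ℤ L) (hS : S.Finite) :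
    (fun T => ((torsionPoints (cosetFreePart S) T).ncard : ℝ)) =O[atTop]
      fun T : ℕ => (T : ℝ) ^ ((finrank ℤ L : ℝ) - 1 / finrank ℤ L) := by
  have : Nonempty (Fin (finrank ℤ L)) := Fin.pos_iff_nonempty.1 hL
  obtain ⟨A, hA⟩ := exists_natAbs_apply_support_le (finBasis ℤ L) hS
  refine IsBigO.of_bound (2 * A * 3 ^ finrank ℤ L * ∑' g : ℕ, 1 / (g : ℝ) ^ 2)
    (Eventually.of_forall fun T => ?_)
  have hcount := (Set.encard_le_coe_iff_finite_ncard_le.1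
    (encard_torsionPoints_cosetFreePart_le (finBasis ℤ L) hA (T := T)
      (by simpa only [Fintype.card_fin] using lt_floor_rpow_add_one_pow hL T))).2
  rw [Fintype.card_fin] at hcount
  rw [Real.norm_of_nonneg (by positivity), Real.norm_of_nonneg (by positivity)]
  grw [hcount, sum_Icc_box_mul_le hL, floor_rpow_pow_le hL]

end CosetFree

section Induction

variable {S : Set (L →₀ K)} {b : L →ₗ[ℤ] ℤ} {f : L}

/-- No torsion coset of codimension one is contained in `X`. Such a coset has the form
`{x | x a = ζ a}`, where `ζ` is a torsion point and the character `a` is primitive, which is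
expressed by a form `φ` with `φ a = 1`. -/
def NoCodimOneTorsionCoset (X : Set (CharTorus K L)) : Prop :=
  ∀ (a : L) (φ : L →ₗ[ℤ] ℤ), φ a = 1 → ∀ ζ : CharTorus K L, IsOfFinOrder ζ →
    ¬ {x : CharTorus K L | x a = ζ a} ⊆ X

theorem NoCodimOneTorsionCoset.kerSystem (h : NoCodimOneTorsionCoset (vanishing S))
    (hf : b f = 1) : NoCodimOneTorsionCoset (vanishing (kerSystem S b f)) := by
  intro a φ hφ ζ hζ hsub
  refine h a (φ ∘ₗ projKer b f hf) (by rw [LinearMap.comp_apply, projKer_coe, hφ])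
    (pullback (projKer b f hf) ζ) (MonoidHom.isOfFinOrder _ hζ) fun x hx => ?_
  refine vanishing_components_subset S b ?_
  rw [vanishing_components_eq_preimage S hf]
  refine hsub (hx.trans ?_)
  rw [pullback_apply, projKer_coe]

theorem NoCodimOneTorsionCoset.torsionPoints_eq_empty {X : Set (CharTorus K L)}
    (h : NoCodimOneTorsionCoset X) [Module.Free ℤ L] (hL : finrank ℤ L = 1) (T : ℕ) :
    torsionPoints X T = ∅ := by
  have : Module.Finite ℤ L := Module.finite_of_finrank_pos (by lia)
  refine Set.eq_empty_of_forall_notMem fun ζ ⟨hζX, hζ, _⟩ => ?_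
  let e := finBasisOfFinrankEq ℤ L hL
  refine h (e 0) (e.coord 0) (by simp) ζ hζ fun x hx => ?_
  have hxζ : x = ζ := ext_of_basis e fun i => Subsingleton.elim 0 i ▸ hx
  rwa [hxζ]

theorem isBigO_ncard_torsionPoints_components [Module.Free ℤ L] [Module.Finite ℤ L]
    (hf : b f = 1) {α : ℝ}
    (h : (fun T => (torsionWeight (vanishing (kerSystem S b f)) T : ℝ)) =O[atTop]
      fun T : ℕ => (T : ℝ) ^ α) :
    (fun T => ((torsionPoints (vanishing (components S b)) T).ncard : ℝ)) =O[atTop]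
      fun T : ℕ => (T : ℝ) ^ (α + 1) := by
  have hle : (fun T => ((torsionPoints (vanishing (components S b)) T).ncard : ℝ)) =O[atTop]
      fun T : ℕ => (T : ℝ) * torsionWeight (vanishing (kerSystem S b f)) T := by
    refine IsBigO.of_bound 1 (Eventually.of_forall fun T => ?_)
    rw [one_mul, Real.norm_of_nonneg (by positivity), Real.norm_of_nonneg (by positivity),
      vanishing_components_eq_preimage S hf]
    exact_mod_cast ncard_torsionPoints_preimage_resKer_le hf _ T
  refine hle.trans ((isBigO_refl _ _).mul h |>.congr' EventuallyEq.rfl ?_)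
  filter_upwards [eventually_gt_atTop 0] with T hT
  rw [Real.rpow_add_one (by exact_mod_cast hT.ne'), mul_comm]

theorem isBigO_ncard_torsionPoints_vanishing [Module.Free ℤ L] [Module.Finite ℤ L]
    (hS : S.Finite) {u : ℕ → ℝ}
    (hfree : (fun T => ((torsionPoints (cosetFreePart S) T).ncard : ℝ)) =O[atTop] u)
    (hcomp : ∀ b f, b f = 1 →
      (fun T => ((torsionPoints (vanishing (components S b)) T).ncard : ℝ)) =O[atTop] u) :
    (fun T => ((torsionPoints (vanishing S) T).ncard : ℝ)) =O[atTop] u := by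
  have hloci : {Z | ∃ b f, b f = 1 ∧ vanishing (components S b) = Z}.Finite :=
    (finite_range_vanishing_components hS).subset fun _ ⟨b, _, _, hZ⟩ => ⟨b, hZ⟩
  have hsum : (fun T => ∑ Z ∈ hloci.toFinset, ((torsionPoints Z T).ncard : ℝ)) =O[atTop] u :=
    IsBigO.fun_sum fun Z hZ => by
      obtain ⟨b, f, hf, rfl⟩ := hloci.mem_toFinset.1 hZ
      exact hcomp b f hf
  refine IsBigO.trans (IsBigO.of_bound 1 (Eventually.of_forall fun T => ?_)) (hfree.add hsum)
  have hsub : torsionPoints (vanishing S) T ⊆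
      torsionPoints (cosetFreePart S) T ∪ ⋃ Z ∈ hloci.toFinset, torsionPoints Z T := by
    rintro ζ ⟨hζS, hζ⟩
    by_cases hζfree : ζ ∈ cosetFreePart S
    · exact Or.inl ⟨hζfree, hζ⟩
    · obtain ⟨b, f, hf, hb⟩ : ∃ b f, b f = 1 ∧ ζ ∈ vanishing (components S b) := by
        by_contra! h
        exact hζfree ⟨hζS, h⟩
      exact Or.inr (Set.mem_biUnion (hloci.mem_toFinset.2 ⟨b, f, hf, rfl⟩) ⟨hb, hζ⟩)
  have hfin : (⋃ Z ∈ hloci.toFinset, torsionPoints Z T).Finite :=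
    (Finset.finite_toSet _).biUnion fun Z _ => finite_torsionPoints Z T
  have hcount : (torsionPoints (vanishing S) T).ncard ≤
      (torsionPoints (cosetFreePart S) T).ncard + ∑ Z ∈ hloci.toFinset, (torsionPoints Z T).ncard :=
    (Set.ncard_le_ncard hsub ((finite_torsionPoints _ T).union hfin)).trans
      ((Set.ncard_union_le _ _).trans (Nat.add_le_add_left (Finset.set_ncard_biUnion_le _ _) _))
  rw [one_mul, Real.norm_of_nonneg (by positivity), Real.norm_of_nonneg (by positivity)]
  exact_mod_cast hcount

theorem isBigO_torsionWeight_vanishing {n : ℕ} (hn : 1 ≤ n) [Module.Free ℤ L]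
    (hL : finrank ℤ L = n) (hS : S.Finite) (h : NoCodimOneTorsionCoset (vanishing S)) :
    (fun T => (torsionWeight (vanishing S) T : ℝ)) =O[atTop]
      fun T : ℕ => (T : ℝ) ^ ((n : ℝ) - 1 / n) := by
  induction n, hn using Nat.le_induction generalizing L with
  | base =>
    simp only [torsionWeight, h.torsionPoints_eq_empty hL, Set.ncard_empty, Finset.sum_const_zero,
      Nat.cast_zero]
    exact isBigO_zero _ _
  | succ n hn ih =>
    have : Module.Finite ℤ L := Module.finite_of_finrank_pos (by lia)
    have hn' : (1 : ℝ) ≤ n := by exact_mod_cast hn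
    have hinv : 1 / ((n : ℝ) + 1) < 1 / n := one_div_lt_one_div_of_lt (by linarith) (by linarith)
    have hinv' : 1 / (n : ℝ) ≤ 1 := (div_le_one (by linarith)).2 hn'
    refine isBigO_sum_Icc_div (by push_cast; linarith)
      (isBigO_ncard_torsionPoints_vanishing hS ?_ fun b f hf => ?_)
    · rw [← hL]
      exact isBigO_ncard_torsionPoints_cosetFreePart (by lia) hS
    · have hker := ih (by have := finrank_ker_add_one hf; lia) (finite_kerSystem hS hf)
        (h.kerSystem hf)
      refine (isBigO_ncard_torsionPoints_components hf hker).trans (isBigO_rpow_rpow_atTop ?_)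
      push_cast
      linarith

end Induction

end CharTorus

namespace Torus

variable {K : Type*} [Field K] {k m n : ℕ}

section Characters

/-- A point of `𝔾_m^n`, as the homomorphism from `ℤ^n` that evaluates monomials at the point. -/
def toChar : Torus K n ≃* CharTorus K (Fin n → ℤ) where
  toFun x :=
    { toFun := fun a => ∏ i, x i ^ a i
      map_zero_eq_one' := by simp
      map_add_eq_mul' := fun a b => by simp [zpow_add, Finset.prod_mul_distrib] }
  invFun χ i := χ (Pi.single i 1)
  left_inv x := by
    funext i
    simp only [AddChar.coe_mk]
    rw [Fintype.prod_eq_single i fun j hj => by rw [Pi.single_eq_of_ne hj, zpow_zero],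
      Pi.single_eq_same, zpow_one]
  right_inv χ := by
    refine CharTorus.ext_of_basis (Pi.basisFun ℤ (Fin n)) fun i => ?_
    simp only [AddChar.coe_mk, Pi.basisFun_apply]
    rw [Fintype.prod_eq_single i fun j hj => by rw [Pi.single_eq_of_ne hj, zpow_zero],
      Pi.single_eq_same, zpow_one]
  map_mul' x y := DFunLike.ext _ _ fun a => by
    simp [mul_zpow, Finset.prod_mul_distrib]

theorem toChar_apply (x : Torus K n) (a : Fin n → ℤ) : toChar x a = ∏ i, x i ^ a i := rfl

theorem toChar_single (x : Torus K n) (i : Fin n) : toChar x (Pi.single i 1) = x i :=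
  congrFun (toChar.symm_apply_apply x) i

theorem eval_eq_charEval (x : Torus K n) (P : LaurentRing K n) :
    eval x P = CharTorus.charEval (toChar x) P.coeff := by
  rw [eval, AddMonoidAlgebra.lift_apply]
  rfl

theorem eval_single (x : Torus K n) (a : Fin n → ℤ) (c : K) :
    eval x (AddMonoidAlgebra.single a c) = c * toChar x a := by
  rw [eval, AddMonoidAlgebra.lift_single, smul_eq_mul]
  rfl

theorem image_toChar_commonZeros (S : Set (LaurentRing K n)) :
    toChar '' commonZeros S = CharTorus.vanishing (AddMonoidAlgebra.coeff '' S) := by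
  ext χ
  obtain ⟨x, rfl⟩ := toChar.surjective χ
  simp [CharTorus.vanishing, commonZeros, eval_eq_charEval]

theorem torsionUpTo_eq_torsionPoints (X : Set (Torus K n)) {T : ℝ} (hT : 0 ≤ T) :
    torsionUpTo X T = torsionPoints X ⌊T⌋₊ :=
  Set.ext fun _ => and_congr_right fun _ => and_congr_right fun _ => (Nat.le_floor_iff hT).symm

end Characters

section MonomialMap

/-- The morphism of tori that is the translate by `ζ` of the homomorphism dual to `p`. -/
def monomialMap (ζ : Torus K m) (p : (Fin m → ℤ) →ₗ[ℤ] (Fin k → ℤ)) (y : Torus K k) : Torus K m :=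
  ζ * toChar.symm (CharTorus.pullback p (toChar y))

theorem toChar_monomialMap (ζ : Torus K m) (p : (Fin m → ℤ) →ₗ[ℤ] (Fin k → ℤ)) (y : Torus K k)
    (a : Fin m → ℤ) : toChar (monomialMap ζ p y) a = toChar ζ a * toChar y (p a) := by
  rw [monomialMap, map_mul, MulEquiv.apply_symm_apply, AddChar.mul_apply, CharTorus.pullback_apply]

theorem exists_eval_eq_eval_monomialMap (ζ : Torus K m) (p : (Fin m → ℤ) →ₗ[ℤ] (Fin k → ℤ))
    (P : LaurentRing K m) : ∃ Q : LaurentRing K k, ∀ y, eval y Q = eval (monomialMap ζ p y) P := by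
  induction P using AddMonoidAlgebra.induction_linear with
  | zero => exact ⟨0, fun y => by rw [map_zero, map_zero]⟩
  | add P₁ P₂ h₁ h₂ =>
    obtain ⟨Q₁, hQ₁⟩ := h₁
    obtain ⟨Q₂, hQ₂⟩ := h₂
    exact ⟨Q₁ + Q₂, fun y => by rw [map_add, map_add, hQ₁, hQ₂]⟩
  | single a c =>
    refine ⟨AddMonoidAlgebra.single (p a) (c * toChar ζ a), fun y => ?_⟩
    rw [eval_single, eval_single, toChar_monomialMap, Units.val_mul, mul_assoc]

end MonomialMap

section Polynomials

theorem exists_laurent_eval_eq (p : MvPolynomial (Fin n) K) :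
    ∃ P : LaurentRing K n, ∀ x, eval x P = MvPolynomial.eval (fun i => (x i : K)) p := by
  refine ⟨MvPolynomial.aeval (fun i => AddMonoidAlgebra.single (Pi.single i 1) 1) p, fun x => ?_⟩
  rw [← AlgHom.comp_apply, MvPolynomial.comp_aeval, ← MvPolynomial.coe_aeval_eq_eval]
  simp only [eval_single, toChar_single, one_mul]
  rfl

theorem exists_mvPolynomial_eval_eq (P : LaurentRing K n) :
    ∃ (p : MvPolynomial (Fin n) K) (N : ℕ), ∀ x : Torus K n,
      MvPolynomial.eval (fun i => (x i : K)) p = (∏ i, (x i : K) ^ N) * eval x P := by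
  obtain ⟨N, hN⟩ : ∃ N : ℕ, ∀ a ∈ P.coeff.support, ∀ i, (a i).natAbs ≤ N := by
    obtain ⟨N, hN⟩ := (P.coeff.support.finite_toSet.image
      fun a : Fin n → ℤ => ∑ i, (a i).natAbs).bddAbove
    exact ⟨N, fun a ha i => (Finset.single_le_sum (f := fun i => (a i).natAbs)
      (fun _ _ => Nat.zero_le _) (Finset.mem_univ i)).trans (hN (Set.mem_image_of_mem _ ha))⟩
  refine ⟨∑ a ∈ P.coeff.support, MvPolynomial.monomial
    (Finsupp.equivFunOnFinite.symm fun i => (a i + N).toNat) (P.coeff a), N, fun x => ?_⟩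
  rw [eval_eq_charEval, CharTorus.charEval, Finsupp.linearCombination_apply, Finsupp.mul_sum,
    map_sum]
  refine Finset.sum_congr rfl fun a ha => ?_
  have hshift (i : Fin n) : (x i : K) ^ (a i + N).toNat = (x i : K) ^ N * (x i : K) ^ a i := by
    have hnonneg : 0 ≤ a i + N := by
      have := hN a ha i
      lia
    rw [← zpow_natCast, Int.toNat_of_nonneg hnonneg, zpow_add₀ (x i).ne_zero, zpow_natCast,
      mul_comm]
  rw [MvPolynomial.eval_monomial, Finsupp.prod_fintype _ _ fun i => pow_zero _]
  simp only [Finsupp.coe_equivFunOnFinite_symm, hshift, Finset.prod_mul_distrib, toChar_apply,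
    Units.coe_prod, Units.val_zpow_eq_zpow_val, smul_eq_mul]
  ring

end Polynomials

end Torus

section IrreducibleSpaces

open Topology TopologicalSpace

variable {X Y : Type*} [TopologicalSpace X] [TopologicalSpace Y]

theorem irreducibleSpace_of_isInducing_of_denseRange [IrreducibleSpace Y] {f : X → Y}
    (hf : IsInducing f) (hd : DenseRange f) : IrreducibleSpace X := by
  have : Nonempty X := hd.nonempty
  refine { isPreirreducible_univ := ?_, toNonempty := ‹_› }
  rintro _ _ hu hv ⟨x, -, hxu⟩ ⟨y, -, hyv⟩
  obtain ⟨u, hu', rfl⟩ := hf.isOpen_iff.1 hu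
  obtain ⟨v, hv', rfl⟩ := hf.isOpen_iff.1 hv
  obtain ⟨z, hz⟩ := hd.exists_mem_open (hu'.inter hv')
    (nonempty_preirreducible_inter hu' hv' ⟨f x, hxu⟩ ⟨f y, hyv⟩)
  exact ⟨z, Set.mem_univ z, hz⟩

theorem topologicalKrullDim_add_one_le [IrreducibleSpace X] {Z : Set X} (hZ : IsClosed Z)
    (hne : Z ≠ Set.univ) : topologicalKrullDim Z + 1 ≤ topologicalKrullDim X := by
  let incl : IrreducibleCloseds Z → IrreducibleCloseds X :=
    IrreducibleCloseds.map Subtype.val continuous_subtype_val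
  have hincl : StrictMono incl := IrreducibleCloseds.map_strictMono_of_isInducing .subtypeVal
  let top : IrreducibleCloseds X := ⟨Set.univ, IrreducibleSpace.isIrreducible_univ X, isClosed_univ⟩
  have htop (A : IrreducibleCloseds Z) : incl A < top := by
    refine lt_of_le_of_ne (Set.subset_univ _) fun h => hne (Set.eq_univ_of_univ_subset ?_)
    have hsub : (incl A : Set X) ⊆ Z := closure_minimal (Subtype.coe_image_subset _ _) hZ
    exact (congrArg SetLike.coe h).symm.subset.trans hsub
  rcases isEmpty_or_nonempty (IrreducibleCloseds Z) with hempty | hnonempty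
  · rw [topologicalKrullDim, Order.krullDim_eq_bot, WithBot.bot_add]
    exact bot_le
  rw [topologicalKrullDim, ← Order.krullDim_WithTop]
  let extend : WithTop (IrreducibleCloseds Z) → IrreducibleCloseds X := WithTop.recTopCoe top incl
  have hextend : StrictMono extend := WithTop.strictMono_iff.2 ⟨hincl, htop⟩
  exact Order.krullDim_le_of_strictMono extend hextend

end IrreducibleSpaces

namespace Torus

variable {K : Type*} [Field K] {k m n : ℕ}

section Zariski

open Topology

attribute [local instance] zariski

theorem isClosed_iff_exists_eq_commonZeros {Z : Set (Torus K n)} :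
    IsClosed Z ↔ ∃ S, Z = commonZeros S := by
  rw [← isOpen_compl_iff]
  change Zᶜᶜ ∈ {X | ∃ S, X = commonZeros S} ↔ _
  rw [compl_compl]
  rfl

theorem IsAlgebraicSet.isClosed {X : Set (Torus K n)} (hX : IsAlgebraicSet X) : IsClosed X := by
  obtain ⟨S, rfl⟩ := hX
  exact isClosed_iff_exists_eq_commonZeros.2 ⟨_, rfl⟩

theorem continuous_monomialMap (ζ : Torus K m) (p : (Fin m → ℤ) →ₗ[ℤ] (Fin k → ℤ)) :
    Continuous (monomialMap ζ p) := by
  choose Q hQ using exists_eval_eq_eval_monomialMap ζ p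
  refine continuous_iff_isClosed.2 fun Z hZ => ?_
  obtain ⟨S, rfl⟩ := isClosed_iff_exists_eq_commonZeros.1 hZ
  refine isClosed_iff_exists_eq_commonZeros.2 ⟨Q '' S, ?_⟩
  ext y
  simp [commonZeros, hQ]

/-- The kernel of evaluation at a point of the torus. This embeds the torus in the spectrum of the
polynomial ring, through which its dimension is computed. -/
noncomputable def toSpec (x : Torus K n) : PrimeSpectrum (MvPolynomial (Fin n) K) :=
  PrimeSpectrum.comap (MvPolynomial.eval fun i => (x i : K)) ⊥

theorem mem_toSpec_asIdeal {x : Torus K n} {p : MvPolynomial (Fin n) K} :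
    p ∈ (toSpec x).asIdeal ↔ MvPolynomial.eval (fun i => (x i : K)) p = 0 := by
  rw [toSpec, PrimeSpectrum.comap_asIdeal, Ideal.mem_comap]
  exact Ideal.mem_bot

theorem isInducing_toSpec : IsInducing (toSpec : Torus K n → _) := by
  refine ⟨TopologicalSpace.ext_isClosed fun Z => ?_⟩
  rw [isClosed_iff_exists_eq_commonZeros, isClosed_induced_iff]
  constructor
  · rintro ⟨S, rfl⟩
    choose p N hp using exists_mvPolynomial_eval_eq (K := K) (n := n)
    refine ⟨_, PrimeSpectrum.isClosed_zeroLocus (p '' S), ?_⟩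
    ext x
    simp [commonZeros, PrimeSpectrum.mem_zeroLocus, Set.subset_def, mem_toSpec_asIdeal, hp,
      Finset.prod_eq_zero_iff]
  · rintro ⟨t, ht, rfl⟩
    obtain ⟨s, rfl⟩ := (PrimeSpectrum.isClosed_iff_zeroLocus t).1 ht
    choose P hP using exists_laurent_eval_eq (K := K) (n := n)
    refine ⟨P '' s, ?_⟩
    ext x
    simp [commonZeros, PrimeSpectrum.mem_zeroLocus, Set.subset_def, mem_toSpec_asIdeal, hP]

theorem denseRange_toSpec [Infinite K] : DenseRange (toSpec : Torus K n → _) := by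
  refine PrimeSpectrum.isTopologicalBasis_basic_opens.dense_iff.2 ?_
  rintro _ ⟨p, rfl⟩ ⟨I, hI⟩
  have hp : p ≠ 0 := fun h => hI (h ▸ I.asIdeal.zero_mem)
  obtain ⟨x, hx⟩ : ∃ x : Torus K n, MvPolynomial.eval (fun i => (x i : K)) p ≠ 0 := by
    by_contra! hzero
    refine hp (MvPolynomial.funext_set (fun _ => {0}ᶜ)
      (fun _ => (Set.finite_singleton 0).infinite_compl) fun y hy => ?_)
    exact (hzero fun i => Units.mk0 (y i) (hy i trivial)).trans (map_zero _).symm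
  exact ⟨toSpec x, fun h => hx (mem_toSpec_asIdeal.1 h), Set.mem_range_self x⟩

instance irreducibleSpace [Infinite K] : IrreducibleSpace (Torus K n) :=
  irreducibleSpace_of_isInducing_of_denseRange isInducing_toSpec denseRange_toSpec

theorem topologicalKrullDim_le : topologicalKrullDim (Torus K n) ≤ n := by
  refine isInducing_toSpec.topologicalKrullDim_le.trans_eq ?_
  rw [PrimeSpectrum.topologicalKrullDim_eq_ringKrullDim,
    MvPolynomial.ringKrullDim_of_isNoetherianRing, ringKrullDim_eq_zero_of_field, zero_add,
    Nat.card_fin]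

/-- The coset through `ζ` of the kernel of the character with exponent `a`. -/
def charCoset (a : Fin n → ℤ) (ζ : Torus K n) : Set (Torus K n) := {x | toChar x a = toChar ζ a}

theorem isAlgebraicSet_charCoset (a : Fin n → ℤ) (ζ : Torus K n) :
    IsAlgebraicSet (charCoset a ζ) := by
  refine ⟨{AddMonoidAlgebra.single a 1 - AddMonoidAlgebra.single 0 (toChar ζ a : K)}, ?_⟩
  ext x
  simp [charCoset, commonZeros, eval_single, sub_eq_zero, Units.ext_iff]

variable {φ : (Fin (m + 1) → ℤ) →ₗ[ℤ] ℤ} {a : Fin (m + 1) → ℤ}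

theorem charCoset_ne_univ [Infinite K] (ha : φ a = 1) (ζ : Torus K (m + 1)) :
    charCoset a ζ ≠ Set.univ := by
  obtain ⟨t, ht⟩ := ({0, (toChar ζ a : K)} : Set K).toFinite.exists_notMem
  obtain ⟨ht0, htζ⟩ : t ≠ 0 ∧ t ≠ toChar ζ a := by simpa using ht
  let u : Kˣ := Units.mk0 t ht0
  let x : CharTorus K (Fin (m + 1) → ℤ) :=
    { toFun := fun b => u ^ φ b
      map_zero_eq_one' := by simp
      map_add_eq_mul' := fun b b' => by rw [map_add, zpow_add] }
  have hx : x a = u := by simp [x, ha]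
  intro huniv
  have hmem : toChar.symm x ∈ charCoset a ζ := huniv ▸ Set.mem_univ _
  rw [charCoset, Set.mem_ofPred_eq, MulEquiv.apply_symm_apply, hx] at hmem
  exact htζ (congrArg Units.val hmem)

theorem exists_isEmbedding_range_eq_charCoset (ha : φ a = 1) (ζ : Torus K (m + 1)) :
    ∃ F : Torus K m → Torus K (m + 1), IsEmbedding F ∧ Set.range F = charCoset a ζ := by
  have hrank : finrank ℤ (LinearMap.ker φ) = m := by
    have := finrank_ker_add_one ha
    simpa using this
  let e := finBasisOfFinrankEq ℤ (LinearMap.ker φ) hrank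
  let p : (Fin (m + 1) → ℤ) →ₗ[ℤ] (Fin m → ℤ) := e.equivFun.toLinearMap ∘ₗ projKer φ a ha
  let q : (Fin m → ℤ) →ₗ[ℤ] (Fin (m + 1) → ℤ) :=
    (LinearMap.ker φ).subtype ∘ₗ e.equivFun.symm.toLinearMap
  let η : Torus K m := (toChar.symm (CharTorus.pullback q (toChar ζ)))⁻¹
  have hpq (b : Fin m → ℤ) : p (q b) = b := by
    simp only [p, q, LinearMap.comp_apply, Submodule.subtype_apply, projKer_coe,
      LinearEquiv.coe_coe, LinearEquiv.apply_symm_apply]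
  have hqp (k : LinearMap.ker φ) : q (p k) = k := by simp [p, q, projKer_coe]
  have hpa : p a = 0 := by
    have : projKer φ a ha a = 0 := Subtype.ext (by simp [coe_projKer, ha])
    simp [p, this]
  have hη (b : Fin m → ℤ) : toChar η b = (toChar ζ (q b))⁻¹ := by
    rw [map_inv, MulEquiv.apply_symm_apply, AddChar.inv_apply', CharTorus.pullback_apply]
  have hleft : Function.LeftInverse (monomialMap η q) (monomialMap ζ p) := by
    refine fun y => toChar.injective (DFunLike.ext _ _ fun b => ?_)
    rw [toChar_monomialMap, toChar_monomialMap, hη, hpq, inv_mul_cancel_left]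
  refine ⟨monomialMap ζ p, hleft.isEmbedding (continuous_monomialMap η q)
    (continuous_monomialMap ζ p), Set.Subset.antisymm ?_ fun x hx => ⟨monomialMap η q x, ?_⟩⟩
  · rintro _ ⟨y, rfl⟩
    simp [charCoset, toChar_monomialMap, hpa]
  · refine toChar.injective (CharTorus.eq_of_resKer_eq ha (DFunLike.ext _ _ fun k => ?_) ?_)
    · rw [CharTorus.resKer_apply, CharTorus.resKer_apply, toChar_monomialMap, toChar_monomialMap,
        hη, hqp, mul_inv_cancel_left]
    · rw [toChar_monomialMap, hpa, AddChar.map_zero_eq_one, mul_one]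
      exact hx.symm

theorem isIrreducible_charCoset [Infinite K] (ha : φ a = 1) (ζ : Torus K (m + 1)) :
    IsIrreducible (charCoset a ζ) := by
  obtain ⟨F, hF, hrange⟩ := exists_isEmbedding_range_eq_charCoset ha ζ
  rw [← hrange, ← Set.image_univ]
  exact (IrreducibleSpace.isIrreducible_univ _).image F hF.continuous.continuousOn

theorem dim_charCoset (ha : φ a = 1) (ζ : Torus K (m + 1)) :
    dim (charCoset a ζ) = topologicalKrullDim (Torus K m) := by
  obtain ⟨F, hF, hrange⟩ := exists_isEmbedding_range_eq_charCoset ha ζ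
  rw [← hrange]
  exact (IsHomeomorph.topologicalKrullDim_eq _ hF.toHomeomorph.isHomeomorph).symm

theorem topologicalKrullDim_eq [Infinite K] (n : ℕ) : topologicalKrullDim (Torus K n) = n := by
  refine topologicalKrullDim_le.antisymm ?_
  induction n with
  | zero =>
    have : Nonempty (TopologicalSpace.IrreducibleCloseds (Torus K 0)) :=
      ⟨⟨Set.univ, IrreducibleSpace.isIrreducible_univ _, isClosed_univ⟩⟩
    exact Order.krullDim_nonneg
  | succ m ih =>
    have hproj : LinearMap.proj (R := ℤ) 0 (Pi.single 0 1 : Fin (m + 1) → ℤ) = (1 : ℤ) := by simp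
    calc ((m + 1 : ℕ) : WithBot ℕ∞) ≤ topologicalKrullDim (Torus K m) + 1 := by
          push_cast
          gcongr
      _ = dim (charCoset (Pi.single 0 1) 1) + 1 := by rw [dim_charCoset hproj]
      _ ≤ topologicalKrullDim (Torus K (m + 1)) :=
          topologicalKrullDim_add_one_le (isAlgebraicSet_charCoset _ _).isClosed
            (charCoset_ne_univ hproj 1)

theorem dim_mono {X Y : Set (Torus K n)} (h : X ⊆ Y) : dim X ≤ dim Y :=
  (IsEmbedding.inclusion h).isInducing.topologicalKrullDim_le

theorem isTorsionCoset_univ [Infinite K] : IsTorsionCoset (Set.univ : Set (Torus K n)) :=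
  ⟨1, ⊤, .one, ⟨⟨∅, by ext; simp [commonZeros]⟩,
    IrreducibleSpace.isIrreducible_univ _⟩, by simp⟩

theorem isTorsionCoset_charCoset [Infinite K] (ha : φ a = 1) {ζ : Torus K (m + 1)}
    (hζ : IsOfFinOrder ζ) : IsTorsionCoset (charCoset a ζ) := by
  let G : Subgroup (Torus K (m + 1)) :=
    (MonoidHom.mk' (fun x : Torus K (m + 1) => toChar x a) fun x y => by
      rw [map_mul, AddChar.mul_apply]).ker
  have hG : (G : Set (Torus K (m + 1))) = charCoset a 1 := by
    ext x
    simp [G, charCoset, MonoidHom.mem_ker]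
  refine ⟨ζ, G, hζ, ⟨hG ▸ isAlgebraicSet_charCoset a 1, hG ▸ isIrreducible_charCoset ha 1⟩, ?_⟩
  ext x
  rw [hG, Set.image_mul_left, Set.mem_preimage, charCoset, charCoset, Set.mem_ofPred_eq,
    Set.mem_ofPred_eq, map_mul, map_inv, map_one, AddChar.mul_apply, AddChar.inv_apply',
    AddChar.one_apply, inv_mul_eq_one, eq_comm]

theorem noCodimOneTorsionCoset_image_toChar [Infinite K] {X : Set (Torus K n)}
    (hX : IsAlgebraicSet X) (h : ∀ C, IsTorsionCoset C → C ⊆ X → dim C ≠ dim X) :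
    CharTorus.NoCodimOneTorsionCoset (toChar '' X) := by
  intro a φ ha χ hχ hsub
  obtain ⟨ζ, rfl⟩ := toChar.surjective χ
  have hζ : IsOfFinOrder ζ := by
    simpa using toChar.symm.toMonoidHom.isOfFinOrder hχ
  have hcoset : charCoset a ζ ⊆ X := fun x hx => (toChar.injective.mem_set_image).1 (hsub hx)
  obtain _ | m := n
  · rw [Subsingleton.elim a 0, map_zero] at ha
    exact absurd ha zero_ne_one
  have hne : X ≠ Set.univ := by
    rintro rfl
    exact h _ isTorsionCoset_univ subset_rfl rfl
  have hdim : dim X ≤ m := by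
    rw [← ENat.WithBot.add_le_add_one_right_iff, ← Nat.cast_succ, ← topologicalKrullDim_eq (K := K)]
    exact topologicalKrullDim_add_one_le hX.isClosed hne
  refine h _ (isTorsionCoset_charCoset ha hζ) hcoset ((dim_mono hcoset).antisymm ?_)
  rwa [dim_charCoset ha, topologicalKrullDim_eq]

end Zariski

section Counting

variable {X : Set (Torus K n)}

theorem finite_torsionPoints (X : Set (Torus K n)) (T : ℕ) : (torsionPoints X T).Finite := by
  rw [← Set.finite_image_iff toChar.injective.injOn, image_torsionPoints]
  exact CharTorus.finite_torsionPoints _ T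

theorem isBigO_ncard_torsionPoints_of_finite (hX : X.Finite) {α : ℝ} (hα : 0 ≤ α) :
    (fun T => ((torsionPoints X T).ncard : ℝ)) =O[atTop] fun T : ℕ => (T : ℝ) ^ α := by
  have hconst : (fun T => ((torsionPoints X T).ncard : ℝ)) =O[atTop]
      fun T : ℕ => (T : ℝ) ^ (0 : ℝ) := by
    refine IsBigO.of_bound X.ncard (Eventually.of_forall fun T => ?_)
    rw [Real.rpow_zero, norm_one, mul_one, Real.norm_of_nonneg (Nat.cast_nonneg _)]
    exact_mod_cast Set.ncard_le_ncard (Set.sep_subset _ _) hX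
  exact hconst.trans (isBigO_rpow_rpow_atTop hα)

theorem isBigO_ncard_torsionPoints_of_forall_isTorsionCoset [Infinite K] (hn : 1 ≤ n)
    (hX : IsAlgebraicSet X) (h : ∀ C, IsTorsionCoset C → C ⊆ X → dim C ≠ dim X) :
    (fun T => ((torsionPoints X T).ncard : ℝ)) =O[atTop]
      fun T : ℕ => (T : ℝ) ^ ((n : ℝ) - 1 / n) := by
  have hcoset := noCodimOneTorsionCoset_image_toChar hX h
  obtain ⟨S, rfl⟩ := hX
  rw [image_toChar_commonZeros] at hcoset
  have hweight := CharTorus.isBigO_torsionWeight_vanishing hn (by simp)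
    (S.finite_toSet.image _) hcoset
  refine IsBigO.trans (IsBigO.of_bound 1 (Eventually.of_forall fun T => ?_)) hweight
  rw [one_mul, Real.norm_of_nonneg (Nat.cast_nonneg _), Real.norm_of_nonneg (Nat.cast_nonneg _),
    ← Set.ncard_image_of_injective _ toChar.injective, image_torsionPoints,
    image_toChar_commonZeros]
  exact_mod_cast ncard_torsionPoints_le_torsionWeight _ T

theorem IsAdmissible.isBigO_ncard_torsionPoints (hX : IsAdmissible X) (hn : 1 ≤ n) :
    (fun T => ((torsionPoints X T).ncard : ℝ)) =O[atTop]
      fun T : ℕ => (T : ℝ) ^ ((n : ℝ) - 1 / n) := by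
  obtain ⟨halg, hfin | ⟨-, hcoset⟩⟩ := hX
  · exact isBigO_ncard_torsionPoints_of_finite hfin (sub_one_div_nonneg hn)
  · rcases finite_or_infinite K with hK | hK
    · exact isBigO_ncard_torsionPoints_of_finite X.toFinite (sub_one_div_nonneg hn)
    · exact isBigO_ncard_torsionPoints_of_forall_isTorsionCoset hn halg hcoset

theorem exists_forall_ncard_torsionUpTo_le {α : ℝ} (hα : 0 ≤ α)
    (h : (fun T => ((torsionPoints X T).ncard : ℝ)) =O[atTop] fun T : ℕ => (T : ℝ) ^ α) :
    ∃ c : ℝ, 0 < c ∧ ∀ T : ℝ, 1 ≤ T → ((torsionUpTo X T).ncard : ℝ) ≤ c * T ^ α := by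
  obtain ⟨c, hc, hbound⟩ := bound_of_isBigO_nat_atTop h
  refine ⟨c, hc, fun T hT => ?_⟩
  have hfloor : (0 : ℝ) < ⌊T⌋₊ := by exact_mod_cast Nat.floor_pos.2 hT
  have hle : ((torsionPoints X ⌊T⌋₊).ncard : ℝ) ≤ c * (⌊T⌋₊ : ℝ) ^ α := by
    simpa [Real.norm_of_nonneg (Real.rpow_nonneg hfloor.le α)] using
      hbound (x := ⌊T⌋₊) (Real.rpow_pos_of_pos hfloor α).ne'
  rw [torsionUpTo_eq_torsionPoints X (by linarith)]
  grw [hle, Nat.floor_le (by linarith)]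

end Counting

end Torus

theorem theorem6_general {K : Type*} [Field K] {n : ℕ} (hn : 1 ≤ n) {X : Set (Torus K n)}
    (hX : Torus.IsAdmissible X) :
    ∃ c : ℝ, 0 < c ∧ ∀ T : ℝ, 1 ≤ T →
      (Torus.torsionUpTo X T).Finite ∧
        ((Torus.torsionUpTo X T).ncard : ℝ) ≤ c * T ^ ((n : ℝ) - 1 / (n : ℝ)) := by
  obtain ⟨c, hc, hbound⟩ := Torus.exists_forall_ncard_torsionUpTo_le
    (sub_one_div_nonneg hn) (hX.isBigO_ncard_torsionPoints hn)
  refine ⟨c, hc, fun T hT => ⟨?_, hbound T hT⟩⟩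
  rw [Torus.torsionUpTo_eq_torsionPoints X (by linarith)]
  exact Torus.finite_torsionPoints X _

theorem theorem6 {K : Type*} [Field K] [IsAlgClosed K] {n : ℕ} (hn : 2 ≤ n)
    (X : Set (Torus K n)) (hX : Torus.IsHypersurface X) (hadm : Torus.IsAdmissible X) :
    ∃ c : ℝ, 0 < c ∧ ∀ T : ℝ, 1 ≤ T →
      (Torus.torsionUpTo X T).Finite ∧
        ((Torus.torsionUpTo X T).ncard : ℝ) ≤ c * T ^ ((n : ℝ) - 1 / (n : ℝ)) :=
  theorem6_general (by lia) hadm
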